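/- Let $X$ be a countable set with the discrete topology, let $m:X\to(0,\infty)$, and let $\ell^2(X,m)$ be the real Hilbert space of functions $u:X\to\mathbb R$ with $\sum_x u(x)^2m(x)<\infty$. Let $b:X\times X\to[0,\infty)$ be a symmetric weighted graph, i.e. $b(x,y)=b(y,x)$, $b(x,x)=0$ and $\sum_y b(x,y)<\infty$ for all $x,y\in X$. Let $C_0(X)$ be the set of finitely supported functions $X\to\mathbb R$, and let $$Q(u,v)=Q_{b,0}(u,v)=\sum_{x,y\in X}b(x,y)\,(u(x)-u(y))(v(x)-v(y))$$ be the associated regular Dirichlet form on $\ell^2(X,m)$, whose domain $\mathcal D(Q)$ is the closure of $C_0(X)$ in the norm $\|u\|_Q=(Q(u,u)+\|u\|^2)^{1/2}$. Let $L$ be the self-adjoint operator associated with $Q$: $f\in D(L)$ and $Lf=g$ if and only if $f\in\mathcal D(Q)$, $g\in\ell^2(X,m)$ and $Q(f,v)=\langle g,v\rangle$ for all $v\in\mathcal D(Q)$. Let $F(X)$ be the set of $u:X\to\mathbb R$ with $\sum_y b(x,y)|u(y)|<\infty$ for every $x\in X$. Suppose that $L$ is critical with ground state $1$. Here critical means that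 there is no nonzero $w:X\to[0,\infty)$ with $Q(v,v)-\sum_x w(x)v(x)^2\ge 0$ for all $v\in C_0(X)$; a ground state of a critical operator is a positive harmonic function, i.e. some $\varphi\in F(X)$ with $\varphi>0$ and $Q(\varphi,v)=0$ for all $v\in C_0(X)$ (as there is no zero-order term, the constant $1$ always is one). Let $W:X\to\mathbb R$ be bounded, let $\lambda\in\mathbb R$, and let $u\in F(X)$ be a generalized eigenfunction of $L+W$ with eigenvalue $\lambda$, i.e. $u\ne0$ and $$Q(u,v)+\sum_{x}W(x)u(x)v(x)m(x)=\lambda\sum_{x}u(x)v(x)m(x)\qquad\text{for all }v\in C_0(X).$$ If $|u|\le 1$ on $X$, then $\lambda\in\sigma(L+W)$, the spectrum of the operator $L+W$ with domain $D(L)$ in $\ell^2(X,m)$. -/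

import Mathlib

open MeasureTheory Filter Topology
open scoped ENNReal

/-- A symmetric weighted graph `b` over a discrete set `X` that carries a measure
`m : X → (0, ∞)` of full support. -/
structure WeightedGraph (X : Type*) where
  /-- edge weights -/
  b : X → X → ℝ
  /-- vertex measure -/
  m : X → ℝ
  b_nonneg : ∀ x y, 0 ≤ b x y
  b_diag : ∀ x, b x x = 0
  b_symm : ∀ x y, b x y = b y x
  b_summable : ∀ x, Summable (b x)
  m_pos : ∀ x, 0 < m x

noncomputable section

namespace WeightedGraph

variable {X : Type*}

/-- The bilinear form `Q_{b,0}(u,v) = ∑_{x,y} b(x,y) (u(x)-u(y)) (v(x)-v(y))`. -/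
def energy (G : WeightedGraph X) (u v : X → ℝ) : ℝ :=
  ∑' p : X × X, G.b p.1 p.2 * (u p.1 - u p.2) * (v p.1 - v p.2)

/-- `Q_{b,0}(u,u) < ∞`. -/
def FiniteEnergy (G : WeightedGraph X) (u : X → ℝ) : Prop :=
  Summable fun p : X × X => G.b p.1 p.2 * (u p.1 - u p.2) ^ 2

/-- The space `F(X)` of functions `u` with `∑_y b(x,y) |u(y)| < ∞` for every `x`. -/
def F (G : WeightedGraph X) : Set (X → ℝ) :=
  {u | ∀ x, Summable fun y => G.b x y * |u y|}

/-- `u ∈ F(X)` solves `(L + W) u = lam u` in the weak sense: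
`Q(u,v) + ⟨W u, v⟩ = lam ⟨u, v⟩` for all finitely supported `v`, where the pairing is the one
of `ℓ²(X,m)`. (All sums converge absolutely, since `u ∈ F(X)` and `v` has finite support.) -/
def IsWeakSolution (G : WeightedGraph X) (W : X → ℝ) (lam : ℝ) (u : X → ℝ) : Prop :=
  u ∈ G.F ∧ ∀ v : X →₀ ℝ,
    G.energy u v + ∑' x, G.m x * (W x * u x * v x) = lam * ∑' x, G.m x * (u x * v x)

/-- A generalized eigenfunction of `L + W` with eigenvalue `lam`: a nonzero `u ∈ F(X)` that
solves `(L + W) u = lam u` weakly. -/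
def IsGeneralizedEigenfunction (G : WeightedGraph X) (W : X → ℝ) (lam : ℝ) (u : X → ℝ) : Prop :=
  u ≠ 0 ∧ G.IsWeakSolution W lam u

/-- `Q = Q_{b,0}` is subcritical: `Q - Q_w ≥ 0` on the finitely supported functions for some
nonzero `w ≥ 0`, where `Q_w(v) = ∑_x w(x) v(x)²`. -/
def IsSubcritical (G : WeightedGraph X) : Prop :=
  ∃ w : X → ℝ, (∀ x, 0 ≤ w x) ∧ w ≠ 0 ∧
    ∀ v : X →₀ ℝ, 0 ≤ G.energy v v - ∑' x, w x * v x ^ 2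

/-- `Q = Q_{b,0}` (which is always nonnegative) is critical, i.e. not subcritical. -/
def IsCritical (G : WeightedGraph X) : Prop := ¬ G.IsSubcritical

/-- `L` is critical with ground state `φ`. The ground state of a critical operator is its positive
harmonic function (on a connected graph it is unique up to a constant factor; the uniqueness is a
consequence of criticality and is not demanded here). For `φ = 1` the last two fields hold
automatically. -/
structure IsCriticalWithGroundState (G : WeightedGraph X) (φ : X → ℝ) : Prop where
  critical : G.IsCritical
  pos : ∀ x, 0 < φ x
  harmonic : G.IsWeakSolution 0 0 φ

theorem FiniteEnergy.add {G : WeightedGraph X} {u v : X → ℝ} (hu : G.FiniteEnergy u)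
    (hv : G.FiniteEnergy v) : G.FiniteEnergy (u + v) := by
  refine Summable.of_nonneg_of_le (fun p => mul_nonneg (G.b_nonneg _ _) (sq_nonneg _)) (fun p => ?_)
    ((hu.mul_left 2).add (hv.mul_left 2))
  have h := G.b_nonneg p.1 p.2
  simp only [Pi.add_apply]
  nlinarith [mul_nonneg h (sq_nonneg ((u p.1 - u p.2) - (v p.1 - v p.2)))]

theorem FiniteEnergy.smul {G : WeightedGraph X} {u : X → ℝ} (c : ℝ) (hu : G.FiniteEnergy u) :
    G.FiniteEnergy (c • u) := by
  refine (Summable.mul_left (c ^ 2) hu).congr fun p => ?_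
  simp only [Pi.smul_apply, smul_eq_mul]
  ring

theorem FiniteEnergy.summable {G : WeightedGraph X} {u v : X → ℝ} (hu : G.FiniteEnergy u)
    (hv : G.FiniteEnergy v) :
    Summable fun p : X × X => G.b p.1 p.2 * (u p.1 - u p.2) * (v p.1 - v p.2) := by
  refine Summable.of_norm_bounded (Summable.add hu hv) fun p => ?_
  have h := G.b_nonneg p.1 p.2
  rw [Real.norm_eq_abs, abs_le]
  constructor <;>
  nlinarith [mul_nonneg h (sq_nonneg ((u p.1 - u p.2) - (v p.1 - v p.2))),
    mul_nonneg h (sq_nonneg ((u p.1 - u p.2) + (v p.1 - v p.2))),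
    mul_nonneg h (sq_nonneg (u p.1 - u p.2)), mul_nonneg h (sq_nonneg (v p.1 - v p.2))]

theorem energy_self_nonneg (G : WeightedGraph X) (u : X → ℝ) : 0 ≤ G.energy u u :=
  tsum_nonneg fun p => by
    have h := mul_nonneg (G.b_nonneg p.1 p.2) (mul_self_nonneg (u p.1 - u p.2))
    nlinarith

theorem energy_add_left {G : WeightedGraph X} {u u' v : X → ℝ} (hu : G.FiniteEnergy u)
    (hu' : G.FiniteEnergy u') (hv : G.FiniteEnergy v) :
    G.energy (u + u') v = G.energy u v + G.energy u' v := by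
  unfold energy
  rw [← Summable.tsum_add (hu.summable hv) (hu'.summable hv)]
  refine tsum_congr fun p => ?_
  simp only [Pi.add_apply]
  ring

theorem energy_smul_left (G : WeightedGraph X) (c : ℝ) (u v : X → ℝ) :
    G.energy (c • u) v = c * G.energy u v := by
  unfold energy
  rw [← tsum_mul_left]
  refine tsum_congr fun p => ?_
  simp only [Pi.smul_apply, smul_eq_mul]
  ring

theorem energy_smul_self (G : WeightedGraph X) (c : ℝ) (u : X → ℝ) :
    G.energy (c • u) (c • u) = c ^ 2 * G.energy u u := by
  unfold energy
  rw [← tsum_mul_left]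
  refine tsum_congr fun p => ?_
  simp only [Pi.smul_apply, smul_eq_mul]
  ring

theorem energy_add_self_le {G : WeightedGraph X} {u v : X → ℝ} (hu : G.FiniteEnergy u)
    (hv : G.FiniteEnergy v) :
    G.energy (u + v) (u + v) ≤ 2 * G.energy u u + 2 * G.energy v v := by
  unfold energy
  rw [← tsum_mul_left, ← tsum_mul_left, ← Summable.tsum_add
    ((hu.summable hu).mul_left 2) ((hv.summable hv).mul_left 2)]
  refine Summable.tsum_le_tsum (fun p => ?_) ((hu.add hv).summable (hu.add hv))
    (((hu.summable hu).mul_left 2).add ((hv.summable hv).mul_left 2))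
  have h := G.b_nonneg p.1 p.2
  simp only [Pi.add_apply]
  nlinarith [mul_nonneg h (sq_nonneg ((u p.1 - u p.2) - (v p.1 - v p.2)))]

theorem finiteEnergy_of_finite {G : WeightedGraph X} {u : X → ℝ}
    (hu : (Function.support u).Finite) : G.FiniteEnergy u := by
  have key : ∀ a : X → X → ℝ, (∀ x y, 0 ≤ a x y) → (∀ x, Summable (a x)) →
      (∀ x y, u x = 0 → a x y = 0) → Summable fun p : X × X => a p.1 p.2 := by
    intro a ha hs h0
    rw [summable_prod_of_nonneg fun p => ha _ _]
    refine ⟨hs, summable_of_hasFiniteSupport (hu.subset fun x hx => ?_)⟩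
    intro hux
    exact hx (by simp [h0 x _ hux])
  have h1 : Summable fun p : X × X => G.b p.1 p.2 * u p.1 ^ 2 :=
    key (fun x y => G.b x y * u x ^ 2) (fun x y => mul_nonneg (G.b_nonneg _ _) (sq_nonneg _))
      (fun x => (G.b_summable x).mul_right _) (fun x y h => by simp [h])
  have h2 : Summable fun p : X × X => G.b p.1 p.2 * u p.2 ^ 2 := by
    refine ((Equiv.prodComm X X).summable_iff.2 h1).congr fun p => ?_
    simp [G.b_symm p.2 p.1]
  refine Summable.of_nonneg_of_le (fun p => mul_nonneg (G.b_nonneg _ _) (sq_nonneg _)) (fun p => ?_)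
    ((h1.mul_left 2).add (h2.mul_left 2))
  nlinarith [mul_nonneg (G.b_nonneg p.1 p.2) (sq_nonneg (u p.1 + u p.2))]

variable [Countable X] [MeasurableSpace X] [DiscreteMeasurableSpace X]

/-- The vertex measure as a measure on `X`: the mass of `{x}` is `m x`. -/
def vertexMeasure (G : WeightedGraph X) : Measure X :=
  Measure.sum fun x => ENNReal.ofReal (G.m x) • Measure.dirac x

theorem vertexMeasure_singleton (G : WeightedGraph X) (x : X) :
    G.vertexMeasure {x} = ENNReal.ofReal (G.m x) := by
  exact Measure.sum_smul_dirac_singleton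

/-- The real Hilbert space `ℓ²(X,m)`. As no point has measure zero, its elements are functions. -/
abbrev L2 (G : WeightedGraph X) : Type _ := Lp ℝ 2 G.vertexMeasure

theorem eq_of_ae (G : WeightedGraph X) {f g : X → ℝ} (h : f =ᵐ[G.vertexMeasure] g) : f = g := by
  have htop : ae G.vertexMeasure = ⊤ := by
    rw [ae_eq_top]
    intro x
    rw [vertexMeasure_singleton]
    simpa using G.m_pos x
  rw [htop] at h
  simpa [EventuallyEq, funext_iff] using h

theorem coe_add (G : WeightedGraph X) (f g : G.L2) : (⇑(f + g) : X → ℝ) = ⇑f + ⇑g :=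
  G.eq_of_ae (Lp.coeFn_add f g)

theorem coe_sub (G : WeightedGraph X) (f g : G.L2) : (⇑(f - g) : X → ℝ) = ⇑f - ⇑g :=
  G.eq_of_ae (Lp.coeFn_sub f g)

theorem coe_smul (G : WeightedGraph X) (c : ℝ) (f : G.L2) : (⇑(c • f) : X → ℝ) = c • ⇑f :=
  G.eq_of_ae (Lp.coeFn_smul c f)

theorem coe_zero (G : WeightedGraph X) : (⇑(0 : G.L2) : X → ℝ) = 0 :=
  G.eq_of_ae (Lp.coeFn_zero ℝ 2 _)

/-- The form domain `D(Q_{b,0})`: the closure of the finitely supported functions in the energy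
norm `‖f‖_Q² = Q(f,f) + ‖f‖²`, taken among the `f ∈ ℓ²(X,m)` of finite energy. On this domain
`Q_{b,0}` is a regular Dirichlet form (for every weighted graph). -/
def formDomain (G : WeightedGraph X) : Submodule ℝ G.L2 where
  carrier := {f | G.FiniteEnergy f ∧ ∃ φ : ℕ → G.L2, (∀ n, (Function.support (φ n)).Finite) ∧
    Tendsto (fun n => G.energy (f - φ n : G.L2) (f - φ n : G.L2) + ‖f - φ n‖ ^ 2) atTop (𝓝 0)}
  zero_mem' := by
    have h0 : G.FiniteEnergy (0 : G.L2) := by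
      rw [coe_zero]; exact finiteEnergy_of_finite (by simp)
    refine ⟨h0, fun _ => 0, fun _ => by rw [coe_zero]; simp, ?_⟩
    have : G.energy (0 : G.L2) (0 : G.L2) = 0 := by
      rw [coe_zero]; simp [energy]
    simpa only [sub_self, norm_zero, this, ne_eq, OfNat.ofNat_ne_zero, not_false_eq_true, zero_pow,
      add_zero] using tendsto_const_nhds
  add_mem' := by
    rintro f g ⟨hf, φ, hφ, hfφ⟩ ⟨hg, ψ, hψ, hgψ⟩
    have hsum : ∀ n, (Function.support (φ n + ψ n : G.L2)).Finite := fun n => by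
      rw [coe_add]
      exact ((hφ n).union (hψ n)).subset (Function.support_add _ _)
    refine ⟨by rw [coe_add]; exact hf.add hg, fun n => φ n + ψ n, hsum, ?_⟩
    have hsub : ∀ (h η : G.L2), G.FiniteEnergy h → (Function.support η).Finite →
        G.FiniteEnergy (h - η : G.L2) := fun h η hh hη => by
      have := hh.add ((finiteEnergy_of_finite hη).smul (-1))
      rw [coe_sub]
      simpa [sub_eq_add_neg] using this
    have hlim := (hfφ.const_mul 2).add (hgψ.const_mul 2)
    simp only [mul_zero, add_zero] at hlim
    refine squeeze_zero (fun n => add_nonneg (G.energy_self_nonneg _) (sq_nonneg _))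
      (fun n => ?_) hlim
    have e : f + g - (φ n + ψ n) = (f - φ n) + (g - ψ n) := by abel
    have h1 := energy_add_self_le (hsub f (φ n) hf (hφ n)) (hsub g (ψ n) hg (hψ n))
    have h2 := norm_add_le (f - φ n) (g - ψ n)
    have h3 := norm_nonneg ((f - φ n) + (g - ψ n))
    rw [e, coe_add]
    nlinarith [sq_nonneg (‖f - φ n‖ - ‖g - ψ n‖)]
  smul_mem' := by
    rintro c f ⟨hf, φ, hφ, hfφ⟩
    refine ⟨by rw [coe_smul]; exact hf.smul c, fun n => c • φ n, fun n => ?_, ?_⟩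
    · rw [coe_smul]
      exact (hφ n).subset (Function.support_const_smul_subset c _)
    · have hlim := hfφ.const_mul (c ^ 2)
      rw [mul_zero] at hlim
      refine hlim.congr fun n => ?_
      rw [← smul_sub, coe_smul, energy_smul_self, norm_smul, mul_pow, Real.norm_eq_abs, sq_abs]
      ring

theorem mem_formDomain_of_finite (G : WeightedGraph X) {f : G.L2}
    (hf : (Function.support f).Finite) : f ∈ G.formDomain := by
  refine ⟨finiteEnergy_of_finite hf, fun _ => f, fun _ => hf, ?_⟩
  have : G.energy (0 : G.L2) (0 : G.L2) = 0 := by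
    rw [coe_zero]; simp [energy]
  simpa only [sub_self, norm_zero, this, ne_eq, OfNat.ofNat_ne_zero, not_false_eq_true, zero_pow,
    add_zero] using tendsto_const_nhds

/-- The graph of the operator associated with the form: all pairs `(f, g)` with `f ∈ D(Q)`,
`g ∈ ℓ²(X,m)` and `Q(f,v) = ⟨g,v⟩` for every `v ∈ D(Q)`. -/
def laplacianGraph (G : WeightedGraph X) : Submodule ℝ (G.L2 × G.L2) where
  carrier := {p | p.1 ∈ G.formDomain ∧ ∀ v ∈ G.formDomain, G.energy p.1 v = inner ℝ p.2 v}
  zero_mem' := ⟨G.formDomain.zero_mem, fun v _ => by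
    simp only [Prod.fst_zero, Prod.snd_zero, inner_zero_left, coe_zero]
    simp [energy]⟩
  add_mem' := by
    rintro p q ⟨hp, hp'⟩ ⟨hq, hq'⟩
    refine ⟨G.formDomain.add_mem hp hq, fun v hv => ?_⟩
    rw [Prod.fst_add, Prod.snd_add, inner_add_left, coe_add, energy_add_left hp.1 hq.1 hv.1,
      hp' v hv, hq' v hv]
  smul_mem' := by
    rintro c p ⟨hp, hp'⟩
    refine ⟨G.formDomain.smul_mem c hp, fun v hv => ?_⟩
    rw [Prod.smul_fst, Prod.smul_snd, real_inner_smul_left, coe_smul, energy_smul_left, hp' v hv]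

theorem laplacianGraph_snd_eq_zero (G : WeightedGraph X) (p : G.L2 × G.L2)
    (hp : p ∈ G.laplacianGraph) (h0 : p.1 = 0) : p.2 = 0 := by
  have key : ∀ v ∈ G.formDomain, inner ℝ p.2 v = 0 := fun v hv => by
    rw [← hp.2 v hv, h0, coe_zero]
    simp [energy]
  have hx : (⇑p.2 : X → ℝ) = ⇑(0 : G.L2) := by
    rw [coe_zero]
    funext x
    have hfin : G.vertexMeasure {x} ≠ ∞ := by
      rw [vertexMeasure_singleton]; exact ENNReal.ofReal_ne_top
    have hmem : indicatorConstLp 2 (measurableSet_singleton x) hfin (1 : ℝ) ∈ G.formDomain := by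
      refine G.mem_formDomain_of_finite ?_
      rw [G.eq_of_ae indicatorConstLp_coeFn]
      exact (Set.finite_singleton x).subset Set.support_indicator_subset
    have h1 := key _ hmem
    rw [real_inner_comm, L2.inner_indicatorConstLp_one, Measure.restrict_singleton,
      integral_smul_measure, integral_dirac, vertexMeasure_singleton,
      ENNReal.toReal_ofReal (G.m_pos x).le] at h1
    simpa [(G.m_pos x).ne'] using h1
  exact Lp.ext (Eventually.of_forall (congrFun hx))

/-- The (unbounded, self-adjoint) operator `L` on `ℓ²(X,m)` associated with the form `Q_{b,0}`. -/
def laplacian (G : WeightedGraph X) : G.L2 →ₗ.[ℝ] G.L2 := G.laplacianGraph.toLinearPMap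

/-- `laplacian` has the intended graph. -/
theorem laplacian_graph (G : WeightedGraph X) : G.laplacian.graph = G.laplacianGraph :=
  Submodule.toLinearPMap_graph_eq _ fun p hp h0 => G.laplacianGraph_snd_eq_zero p hp h0

theorem memLp_potential_mul (G : WeightedGraph X) (W : lp (fun _ : X => ℝ) ∞) (f : G.L2) :
    MemLp (fun x => W x * f x) 2 G.vertexMeasure :=
  (Lp.memLp f).of_le_mul (c := ‖W‖) (Measurable.of_discrete).aestronglyMeasurable
    (Eventually.of_forall fun x => by
      rw [norm_mul]
      exact mul_le_mul_of_nonneg_right (lp.norm_apply_le_norm ENNReal.top_ne_zero W x)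
        (norm_nonneg _))

/-- Multiplication by a bounded function `W` as an operator on `ℓ²(X,m)`. -/
def potentialMul (G : WeightedGraph X) (W : lp (fun _ : X => ℝ) ∞) : G.L2 →ₗ[ℝ] G.L2 where
  toFun f := (G.memLp_potential_mul W f).toLp
  map_add' f g := by
    rw [← MemLp.toLp_add]
    congr 1
    rw [coe_add]
    funext x
    simp [mul_add]
  map_smul' c f := by
    rw [RingHom.id_apply, ← MemLp.toLp_const_smul]
    congr 1
    rw [coe_smul]
    funext x
    simp [mul_left_comm]

/-- The Schrödinger operator `L + W`, with the domain of `L`. -/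
def schrodinger (G : WeightedGraph X) (W : lp (fun _ : X => ℝ) ∞) : G.L2 →ₗ.[ℝ] G.L2 :=
  G.potentialMul W +ᵥ G.laplacian

end WeightedGraph

/-- The real spectrum of a partially defined operator `A`: all `lam` for which `A - lam` has no
everywhere defined bounded inverse. -/
def LinearPMap.realSpectrum {E : Type*} [NormedAddCommGroup E] [NormedSpace ℝ E]
    (A : E →ₗ.[ℝ] E) : Set ℝ :=
  {lam | ¬ ∃ R : E →L[ℝ] E,
    (∀ g : E, ∃ h : R g ∈ A.domain, A ⟨R g, h⟩ - lam • R g = g) ∧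
      ∀ f : A.domain, R (A f - lam • (f : E)) = f}

end

/-! This is a Weyl-type argument carried out with forms, since cut-offs of `u` need not lie in the
domain of `L`. Criticality means that vertices have zero capacity: for a vertex `x` with `u x ≠ 0`
there are finitely supported `e` with `e x = 1` and `Q(e,e)` arbitrarily small
(`IsCritical.exists_energy_lt`). The functions `f = e * u` are approximate eigenfunctions in the
form sense: `Q(f,v) + ⟨(W - lam) f, v⟩` has square at most `Q(e,e)` times a fixed multiple of
`Q(v,v) + ‖v‖²` (`IsWeakSolution.sq_energy_mul_sub_le`). The boundedness of `u` enters here, through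
a Caccioppoli inequality that controls the gradient of `u` weighted by `v`. Density extends the
estimate to the form domain (`sq_energy_add_inner_le`).

If `lam` had a bounded resolvent `R`, then `v = R f` would be admissible. The left side is then `‖f‖
^ 4`, while `Q(v,v)` and `‖v‖²` are bounded by multiples of `‖f‖²`. Hence `‖f‖²` is at most a
constant times `Q(e,e)`, which contradicts `‖f‖² ≥ m(x) u(x)² > 0`. -/

/-! ### Cauchy–Schwarz for weighted sums and for the energy. -/

theorem summable_mul_mul_of_sq {ι : Type*} {w f g : ι → ℝ} (hw : ∀ i, 0 ≤ w i)
    (hf : Summable fun i => w i * f i ^ 2) (hg : Summable fun i => w i * g i ^ 2) :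
    Summable fun i => w i * f i * g i := by
  refine Summable.of_norm_bounded (hf.add hg) fun i => ?_
  have h := hw i
  rw [Real.norm_eq_abs, abs_le]
  constructor <;>
  nlinarith [mul_nonneg h (sq_nonneg (f i - g i)), mul_nonneg h (sq_nonneg (f i + g i)),
    mul_nonneg h (sq_nonneg (f i)), mul_nonneg h (sq_nonneg (g i))]

/-- The Cauchy–Schwarz inequality for weighted sums. -/
theorem sq_tsum_mul_mul_le {ι : Type*} {w f g : ι → ℝ} (hw : ∀ i, 0 ≤ w i)
    (hf : Summable fun i => w i * f i ^ 2) (hg : Summable fun i => w i * g i ^ 2) :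
    (∑' i, w i * f i * g i) ^ 2 ≤ (∑' i, w i * f i ^ 2) * ∑' i, w i * g i ^ 2 := by
  have hfg := summable_mul_mul_of_sq hw hf hg
  -- The quadratic in `t` is the weighted square sum of `t f + g`; being nonnegative, it has
  -- nonpositive discriminant.
  have key : ∀ t : ℝ, 0 ≤ (∑' i, w i * f i ^ 2) * (t * t) + (2 * ∑' i, w i * f i * g i) * t
      + ∑' i, w i * g i ^ 2 := by
    intro t
    have : (∑' i, w i * f i ^ 2) * (t * t) + (2 * ∑' i, w i * f i * g i) * t
        + ∑' i, w i * g i ^ 2 = ∑' i, w i * (t * f i + g i) ^ 2 := by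
      rw [← tsum_mul_right, ← tsum_mul_left, ← tsum_mul_right,
        ← Summable.tsum_add (hf.mul_right _) ((hfg.mul_left 2).mul_right t),
        ← Summable.tsum_add ((hf.mul_right _).add ((hfg.mul_left 2).mul_right t)) hg]
      exact tsum_congr fun i => by ring
    rw [this]
    exact tsum_nonneg fun i => mul_nonneg (hw i) (sq_nonneg _)
  have := discrim_le_zero key
  unfold discrim at this
  nlinarith

namespace WeightedGraph

variable {X : Type*} {G : WeightedGraph X}

theorem energy_self (G : WeightedGraph X) (u : X → ℝ) :
    G.energy u u = ∑' p : X × X, G.b p.1 p.2 * (u p.1 - u p.2) ^ 2 :=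
  tsum_congr fun p => by ring

theorem energy_comm (G : WeightedGraph X) (u v : X → ℝ) : G.energy u v = G.energy v u :=
  tsum_congr fun p => by ring

theorem sq_energy_le {u v : X → ℝ} (hu : G.FiniteEnergy u) (hv : G.FiniteEnergy v) :
    G.energy u v ^ 2 ≤ G.energy u u * G.energy v v := by
  rw [energy_self, energy_self]
  exact sq_tsum_mul_mul_le (fun p => G.b_nonneg p.1 p.2) hu hv

theorem summable_b_mul_fst {a : X → ℝ} (ha : (Function.support a).Finite) (h0 : ∀ x, 0 ≤ a x) :
    Summable fun p : X × X => G.b p.1 p.2 * a p.1 := by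
  rw [summable_prod_of_nonneg fun p => mul_nonneg (G.b_nonneg p.1 p.2) (h0 p.1)]
  refine ⟨fun x => (G.b_summable x).mul_right (a x), ?_⟩
  have h : ∀ x, ∑' y, G.b x y * a x = (∑' y, G.b x y) * a x := fun x => tsum_mul_right
  simp only [h]
  exact summable_of_hasFiniteSupport (ha.subset (Function.support_mul_subset_right _ _))

theorem summable_b_mul_snd {a : X → ℝ} (ha : (Function.support a).Finite) (h0 : ∀ x, 0 ≤ a x) :
    Summable fun p : X × X => G.b p.1 p.2 * a p.2 :=
  (summable_b_mul_fst (G := G) ha h0).prod_symm.congr fun p => by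
    rw [Prod.fst_swap, Prod.snd_swap, G.b_symm p.2 p.1]

/-! ### Zero capacity of vertices. -/

/-- Criticality forces the capacity of every vertex to vanish. -/
theorem IsCritical.exists_energy_lt (hG : G.IsCritical) (x : X) {ε : ℝ} (hε : 0 < ε) :
    ∃ e : X →₀ ℝ, e x = 1 ∧ G.energy e e < ε := by
  classical
  by_contra! h
  -- By scaling, a lower bound `ε` on the energy of all `e` with `e x = 1` gives `Q(v,v) ≥ ε v(x)²`,
  -- so `ε` times the indicator of `x` is a forbidden weight.
  refine hG ⟨Pi.single x ε, fun y => ?_, fun h0 => ?_, fun v => ?_⟩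
  · by_cases hy : y = x
    · subst hy; simpa using hε.le
    · simp [hy]
  · have := congrFun h0 x
    simp at this
    exact hε.ne' this
  · rw [tsum_eq_single x fun y hy => by simp [hy], Pi.single_eq_same]
    by_cases hv : v x = 0
    · simpa [hv] using G.energy_self_nonneg v
    · have h1 := h ((v x)⁻¹ • v) (by simp [hv])
      rw [Finsupp.coe_smul, energy_smul_self, inv_pow] at h1
      have h2 : 0 < v x ^ 2 := by positivity
      rw [inv_mul_eq_div, le_div_iff₀ h2] at h1
      linarith

/-! ### Estimates for bounded generalized eigenfunctions. -/

theorem IsWeakSolution.energy_eq {W u v : X → ℝ} {lam : ℝ} (hu : G.IsWeakSolution W lam u)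
    (hv : (Function.support v).Finite) :
    G.energy u v = ∑' x, G.m x * ((lam - W x) * u x * v x) := by
  have h := hu.2 (Finsupp.ofSupportFinite v hv)
  rw [Finsupp.ofSupportFinite_coe] at h
  have h1 : Summable fun x => G.m x * (W x * u x * v x) :=
    summable_of_hasFiniteSupport (hv.subset fun x hx h0 => hx (by simp [h0]))
  have h2 : Summable fun x => G.m x * (u x * v x) :=
    summable_of_hasFiniteSupport (hv.subset fun x hx h0 => hx (by simp [h0]))
  rw [eq_sub_of_add_eq h, ← tsum_mul_left, ← Summable.tsum_sub (h2.mul_left _) h1]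
  exact tsum_congr fun x => by ring

theorem summable_gradient_mul_snd {u v : X → ℝ} (hu1 : ∀ x, |u x| ≤ 1)
    (hv : (Function.support v).Finite) :
    Summable fun p : X × X => G.b p.1 p.2 * ((u p.1 - u p.2) * v p.2) ^ 2 := by
  have hs : (Function.support fun x => v x ^ 2).Finite :=
    hv.subset fun x hx h0 => hx (by simp [h0])
  refine Summable.of_nonneg_of_le (fun p => mul_nonneg (G.b_nonneg _ _) (sq_nonneg _)) (fun p => ?_)
    ((summable_b_mul_snd (G := G) hs fun x => sq_nonneg _).mul_left 4)
  have h1 := abs_le.1 (hu1 p.1)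
  have h2 := abs_le.1 (hu1 p.2)
  have h3 : (u p.1 - u p.2) ^ 2 ≤ 4 := by nlinarith
  rw [mul_pow, mul_left_comm]
  exact mul_le_mul_of_nonneg_right h3 (mul_nonneg (G.b_nonneg _ _) (sq_nonneg _))

/-- A Caccioppoli inequality for bounded generalized eigenfunctions. -/
theorem IsWeakSolution.tsum_gradient_mul_le {W u v : X → ℝ} {lam D : ℝ}
    (hu : G.IsWeakSolution W lam u) (hu1 : ∀ x, |u x| ≤ 1) (hD : ∀ x, |lam - W x| ≤ D)
    (hv : (Function.support v).Finite) :
    ∑' p : X × X, G.b p.1 p.2 * ((u p.1 - u p.2) * v p.2) ^ 2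
      ≤ 2 * D * (∑' x, G.m x * v x ^ 2) + 4 * G.energy v v := by
  have hS := summable_gradient_mul_snd (G := G) hu1 hv
  have hT : Summable fun p : X × X => G.b p.1 p.2 * ((u p.1 - u p.2) * v p.1) ^ 2 :=
    ((Equiv.prodComm X X).summable_iff.2 hS).congr fun p => by
      simp [G.b_symm p.2 p.1]; left; ring
  have hST : ∑' p : X × X, G.b p.1 p.2 * ((u p.1 - u p.2) * v p.1) ^ 2
      = ∑' p : X × X, G.b p.1 p.2 * ((u p.1 - u p.2) * v p.2) ^ 2 := by
    rw [← (Equiv.prodComm X X).tsum_eq fun p : X × X => G.b p.1 p.2 * ((u p.1 - u p.2) * v p.2) ^ 2]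
    refine tsum_congr fun p => ?_
    simp [G.b_symm p.2 p.1]; left; ring
  have hE : G.FiniteEnergy v := finiteEnergy_of_finite hv
  have hG : Summable fun p : X × X => G.b p.1 p.2 * (u p.1 * (v p.1 - v p.2)) ^ 2 := by
    refine Summable.of_nonneg_of_le (fun p => mul_nonneg (G.b_nonneg _ _) (sq_nonneg _))
      (fun p => ?_) hE
    refine mul_le_mul_of_nonneg_left ?_ (G.b_nonneg _ _)
    rw [mul_pow]
    exact mul_le_of_le_one_left (sq_nonneg _) ((sq_le_one_iff_abs_le_one _).2 (hu1 _))
  have hfin : (Function.support fun x => u x * v x ^ 2).Finite :=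
    hv.subset fun x hx h0 => hx (by simp [h0])
  -- `u` itself may have infinite energy, so summability comes from expanding the product into terms
  -- that carry `v` or its gradient.
  have hQ : Summable fun p : X × X => G.b p.1 p.2 * (u p.1 - u p.2)
      * (u p.1 * v p.1 ^ 2 - u p.2 * v p.2 ^ 2) := by
    refine ((hS.add (summable_mul_mul_of_sq (fun p : X × X => G.b_nonneg p.1 p.2) hG hS)).add
      (summable_mul_mul_of_sq (fun p : X × X => G.b_nonneg p.1 p.2) hG hT)).congr fun p => ?_
    ring
  -- The Caccioppoli test function `u v²` is inserted into the equation.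
  have hle : G.energy u (fun x => u x * v x ^ 2) ≤ D * ∑' x, G.m x * v x ^ 2 := by
    rw [hu.energy_eq hfin, ← tsum_mul_left]
    refine Summable.tsum_le_tsum (fun x => ?_)
      (summable_of_hasFiniteSupport (hv.subset fun x hx h0 => hx (by simp [h0])))
      (summable_of_hasFiniteSupport (hv.subset fun x hx h0 => hx (by simp [h0])))
    have h1 : u x ^ 2 ≤ 1 := (sq_le_one_iff_abs_le_one _).2 (hu1 x)
    have h2 : (lam - W x) * u x ^ 2 ≤ D := by
      have := le_of_abs_le (hD x)
      have := (abs_nonneg _).trans (hD x)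
      nlinarith [sq_nonneg (u x)]
    have h3 := mul_nonneg (G.m_pos x).le (sq_nonneg (v x))
    nlinarith [mul_le_mul_of_nonneg_left h2 h3]
  -- Uses `(u₁-u₂)(u₁v₁²-u₂v₂²) = (u₁-u₂)²v₂² + u₁(u₁-u₂)(v₁-v₂)(v₁+v₂)`. Young's inequality `-ab ≤
  -- a²/4 + b²` is applied to the `v₁` and `v₂` parts of the last term; by symmetry the two quarters
  -- amount to half of the left side and are absorbed.
  have hmain : ∑' p : X × X, G.b p.1 p.2 * ((u p.1 - u p.2) * v p.2) ^ 2
      ≤ G.energy u (fun x => u x * v x ^ 2)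
        + (1 / 4 * (∑' p : X × X, G.b p.1 p.2 * ((u p.1 - u p.2) * v p.2) ^ 2)
        + 1 / 4 * (∑' p : X × X, G.b p.1 p.2 * ((u p.1 - u p.2) * v p.1) ^ 2)
        + 2 * G.energy v v) := by
    rw [energy_self]
    unfold energy
    rw [← tsum_mul_left, ← tsum_mul_left, ← tsum_mul_left,
      ← Summable.tsum_add (hS.mul_left _) (hT.mul_left _),
      ← Summable.tsum_add ((hS.mul_left _).add (hT.mul_left _)) (Summable.mul_left 2 hE),
      ← Summable.tsum_add hQ (((hS.mul_left _).add (hT.mul_left _)).add (Summable.mul_left 2 hE))]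
    refine Summable.tsum_le_tsum (fun p => ?_) hS
      (hQ.add (((hS.mul_left _).add (hT.mul_left _)).add (Summable.mul_left 2 hE)))
    have hb := G.b_nonneg p.1 p.2
    have h1 : u p.1 ^ 2 ≤ 1 := (sq_le_one_iff_abs_le_one _).2 (hu1 _)
    have h2 := mul_nonneg hb (mul_nonneg (sub_nonneg.2 h1) (sq_nonneg (v p.1 - v p.2)))
    have h3 := mul_nonneg hb
      (sq_nonneg ((u p.1 - u p.2) * v p.2 / 2 + u p.1 * (v p.1 - v p.2)))
    have h4 := mul_nonneg hb
      (sq_nonneg ((u p.1 - u p.2) * v p.1 / 2 + u p.1 * (v p.1 - v p.2)))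
    linear_combination h3 + h4 + 2 * h2
  rw [hST] at hmain
  linarith

/-- The product of a bounded generalized eigenfunction with a finitely supported function `e` solves
the eigenvalue equation up to an error controlled by the energy of `e`. -/
theorem IsWeakSolution.sq_energy_mul_sub_le {W u e v : X → ℝ} {lam D : ℝ}
    (hu : G.IsWeakSolution W lam u) (hu1 : ∀ x, |u x| ≤ 1) (hD : ∀ x, |lam - W x| ≤ D)
    (he : (Function.support e).Finite) (hv : (Function.support v).Finite) :
    (G.energy (e * u) v - ∑' x, G.m x * ((lam - W x) * (e * u) x * v x)) ^ 2
      ≤ G.energy e e * (10 * G.energy v v + 4 * D * ∑' x, G.m x * v x ^ 2) := by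
  have hS := summable_gradient_mul_snd (G := G) hu1 hv
  have hEe : G.FiniteEnergy e := finiteEnergy_of_finite he
  have hEv : G.FiniteEnergy v := finiteEnergy_of_finite hv
  have hEeu : G.FiniteEnergy (e * u) :=
    finiteEnergy_of_finite (he.subset fun x hx h0 => hx (by simp [h0]))
  have hle : ∀ p : X × X, G.b p.1 p.2 * (u p.2 * (v p.1 - v p.2)) ^ 2
      ≤ G.b p.1 p.2 * (v p.1 - v p.2) ^ 2 := fun p => by
    refine mul_le_mul_of_nonneg_left ?_ (G.b_nonneg _ _)
    rw [mul_pow]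
    exact mul_le_of_le_one_left (sq_nonneg _) ((sq_le_one_iff_abs_le_one _).2 (hu1 _))
  have hG : Summable fun p : X × X => G.b p.1 p.2 * (u p.2 * (v p.1 - v p.2)) ^ 2 :=
    Summable.of_nonneg_of_le (fun p => mul_nonneg (G.b_nonneg _ _) (sq_nonneg _)) hle hEv
  have hb : ∀ p : X × X, 0 ≤ G.b p.1 p.2 := fun p => G.b_nonneg p.1 p.2
  have s1 := summable_mul_mul_of_sq hb hEe hG
  have s2 := summable_mul_mul_of_sq hb hEe hS
  have c1 := sq_tsum_mul_mul_le hb hEe hG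
  have c2 := sq_tsum_mul_mul_le hb hEe hS
  have hC := hu.tsum_gradient_mul_le hu1 hD hv
  have hGle : ∑' p : X × X, G.b p.1 p.2 * (u p.2 * (v p.1 - v p.2)) ^ 2 ≤ G.energy v v := by
    rw [energy_self]
    exact Summable.tsum_le_tsum hle hG hEv
  have hev : G.energy u (e * v) = ∑' x, G.m x * ((lam - W x) * (e * u) x * v x) := by
    rw [hu.energy_eq (he.subset fun x hx h0 => hx (by simp [h0]))]
    exact tsum_congr fun x => by simp only [Pi.mul_apply]; ring
  -- Leibniz rule: moving `e` from one argument of the energy to the other leaves only terms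
  -- containing the gradient of `e`.
  have hdiff : G.energy u (e * v) = G.energy (e * u) v
      - (∑' p : X × X, G.b p.1 p.2 * (e p.1 - e p.2) * (u p.2 * (v p.1 - v p.2)))
      + ∑' p : X × X, G.b p.1 p.2 * (e p.1 - e p.2) * ((u p.1 - u p.2) * v p.2) := by
    unfold energy
    rw [← Summable.tsum_sub (hEeu.summable hEv) s1,
      ← Summable.tsum_add ((hEeu.summable hEv).sub s1) s2]
    refine tsum_congr fun p => ?_
    simp only [Pi.mul_apply]
    ring
  rw [← energy_self] at c1 c2
  rw [← hev, hdiff]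
  have h0 := G.energy_self_nonneg e
  have c1' := c1.trans (mul_le_mul_of_nonneg_left hGle h0)
  have c2' := c2.trans (mul_le_mul_of_nonneg_left hC h0)
  generalize (∑' p : X × X, G.b p.1 p.2 * (e p.1 - e p.2) * (u p.2 * (v p.1 - v p.2))) = A at *
  generalize (∑' p : X × X, G.b p.1 p.2 * (e p.1 - e p.2) * ((u p.1 - u p.2) * v p.2)) = B at *
  -- The error is `A - B`, and `(A - B)² ≤ 2A² + 2B²` gives the constants `10 = 2 + 2·4` and `4D =
  -- 2·2D`.
  nlinarith [sq_nonneg (A + B)]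

variable [Countable X] [MeasurableSpace X] [DiscreteMeasurableSpace X]

/-! ### The Hilbert space `ℓ²(X,m)` in coordinates. -/

theorem integral_vertexMeasure {f : X → ℝ} (hf : Integrable f G.vertexMeasure) :
    HasSum (fun x => G.m x * f x) (∫ x, f x ∂G.vertexMeasure) := by
  refine (hasSum_integral_measure hf).congr_fun fun x => ?_
  rw [integral_smul_measure, integral_dirac, ENNReal.toReal_ofReal (G.m_pos x).le, smul_eq_mul]

theorem inner_eq_tsum (f g : G.L2) : inner ℝ f g = ∑' x, G.m x * (f x * g x) := by
  rw [L2.inner_def]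
  refine (integral_vertexMeasure (L2.integrable_inner f g)).tsum_eq.symm.trans ?_
  exact tsum_congr fun x => by simp [mul_comm]

theorem exists_coe_eq {f : X → ℝ} (hf : (Function.support f).Finite) : ∃ g : G.L2, ⇑g = f := by
  classical
  have hfin : ∀ x, G.vertexMeasure {x} ≠ ∞ := fun x => by
    rw [vertexMeasure_singleton]; exact ENNReal.ofReal_ne_top
  have hsum : MemLp (fun y => ∑ x ∈ hf.toFinset, Set.indicator {x} (fun _ => f x) y) 2
      G.vertexMeasure :=
    memLp_finsetSum _ fun x _ =>
      memLp_indicator_const 2 (measurableSet_singleton x) (f x) (Or.inr (hfin x))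
  refine ⟨hsum.toLp, (G.eq_of_ae hsum.coeFn_toLp).trans (funext fun y => ?_)⟩
  by_cases hy : f y = 0 <;> simp [Set.indicator_apply, hy, Finset.sum_ite_eq]

theorem potentialMul_apply (W : lp (fun _ : X => ℝ) ∞) (f : G.L2) (x : X) :
    G.potentialMul W f x = W x * f x :=
  congrFun (G.eq_of_ae (MemLp.coeFn_toLp (G.memLp_potential_mul W f))) x

theorem norm_potentialMul_le (W : lp (fun _ : X => ℝ) ∞) (f : G.L2) :
    ‖G.potentialMul W f‖ ≤ ‖W‖ * ‖f‖ :=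
  Lp.norm_le_mul_norm_of_ae_le_mul (Eventually.of_forall fun x => by
    rw [potentialMul_apply, norm_mul]
    exact mul_le_mul_of_nonneg_right (lp.norm_apply_le_norm ENNReal.top_ne_zero W x)
      (norm_nonneg _))

theorem inner_potentialMul_comm (W : lp (fun _ : X => ℝ) ∞) (f g : G.L2) :
    inner ℝ (G.potentialMul W f) g = inner ℝ f (G.potentialMul W g) := by
  rw [inner_eq_tsum, inner_eq_tsum]
  exact tsum_congr fun x => by rw [potentialMul_apply, potentialMul_apply]; ring

theorem norm_sq_eq_tsum (f : G.L2) : ‖f‖ ^ 2 = ∑' x, G.m x * f x ^ 2 := by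
  rw [← real_inner_self_eq_norm_sq, inner_eq_tsum]
  exact tsum_congr fun x => by ring

theorem mul_sq_le_norm_sq (f : G.L2) (x : X) : G.m x * f x ^ 2 ≤ ‖f‖ ^ 2 := by
  have h : Summable fun x => G.m x * f x ^ 2 :=
    (integral_vertexMeasure (L2.integrable_inner f f)).summable.congr fun x => by simp [sq]
  rw [norm_sq_eq_tsum]
  exact h.le_tsum x fun y _ => mul_nonneg (G.m_pos y).le (sq_nonneg _)

/-! ### Passage to the form domain. -/

/-- A bound on the form of a finitely supported function extends from finitely supported test
functions to the form domain. -/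
theorem sq_energy_add_inner_le {f g : G.L2} {a b : ℝ} (hf : (Function.support f).Finite)
    (ha : 0 ≤ a) (hb : 0 ≤ b)
    (h : ∀ v : G.L2, (Function.support v).Finite →
      (G.energy f v + inner ℝ g v) ^ 2 ≤ a * G.energy v v + b * ‖v‖ ^ 2)
    {v : G.L2} (hv : v ∈ G.formDomain) :
    (G.energy f v + inner ℝ g v) ^ 2 ≤ 4 * (a * G.energy v v + b * ‖v‖ ^ 2) := by
  obtain ⟨hvE, φ, hφ, hlim⟩ := hv
  have hfE : G.FiniteEnergy f := finiteEnergy_of_finite hf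
  -- `c` multiplies the squared form norm of `v - φ n`, which tends to zero. The factor `4` in the
  -- conclusion arises from two uses of `(s + t)² ≤ 2s² + 2t²`, which suffices here.
  set c : ℝ := 4 * (a + b) + 4 * (G.energy f f + ‖g‖ ^ 2) with hc
  have hlim' := (hlim.const_mul c).const_add (4 * (a * G.energy v v + b * ‖v‖ ^ 2))
  rw [mul_zero, add_zero] at hlim'
  refine ge_of_tendsto' hlim' fun n => ?_
  have hφE : G.FiniteEnergy (φ n) := finiteEnergy_of_finite (hφ n)
  have hdE : G.FiniteEnergy (v - φ n : G.L2) := by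
    rw [coe_sub, sub_eq_add_neg, ← neg_one_smul ℝ]
    exact hvE.add (hφE.smul (-1))
  have hsplit : G.energy f v = G.energy f (φ n) + G.energy f (v - φ n : G.L2) := by
    rw [G.energy_comm f (φ n), G.energy_comm f (v - φ n : G.L2),
      ← energy_add_left hφE hdE hfE, ← coe_add, add_sub_cancel, energy_comm]
  have hsplit' : inner ℝ g v = inner ℝ g (φ n) + (inner ℝ g (v - φ n) : ℝ) := by
    rw [← inner_add_right, add_sub_cancel]
  have hφe : φ n = v + (-1 : ℝ) • (v - φ n) := by module
  have hQ : G.energy (φ n) (φ n)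
      ≤ 2 * G.energy v v + 2 * G.energy (v - φ n : G.L2) (v - φ n : G.L2) := by
    have := energy_add_self_le hvE (hdE.smul (-1))
    rw [energy_smul_self, ← coe_smul, ← coe_add, ← hφe] at this
    linarith
  have hN : ‖φ n‖ ^ 2 ≤ 2 * ‖v‖ ^ 2 + 2 * ‖v - φ n‖ ^ 2 := by
    have := norm_sub_le v (v - φ n)
    rw [sub_sub_cancel] at this
    nlinarith [norm_nonneg (φ n), sq_nonneg (‖v‖ - ‖v - φ n‖)]
  have h1 := h (φ n) (hφ n)
  have h2 := sq_energy_le hfE hdE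
  have h3 : inner ℝ g (v - φ n) ^ 2 ≤ ‖g‖ ^ 2 * ‖v - φ n‖ ^ 2 := by
    rw [← mul_pow]
    exact sq_le_sq' (neg_le_of_abs_le (abs_real_inner_le_norm _ _)) (real_inner_le_norm _ _)
  have e1 := G.energy_self_nonneg f
  have e2 := G.energy_self_nonneg (v - φ n : G.L2)
  have hQ' := mul_le_mul_of_nonneg_left hQ ha
  have hN' := mul_le_mul_of_nonneg_left hN hb
  rw [hsplit, hsplit', hc]
  generalize G.energy f (φ n) = p1 at *
  generalize G.energy f (v - φ n : G.L2) = p2 at *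
  generalize (inner ℝ g (φ n) : ℝ) = p3 at *
  generalize (inner ℝ g (v - φ n) : ℝ) = p4 at *
  generalize G.energy (v - φ n : G.L2) (v - φ n : G.L2) = q at *
  generalize G.energy f f = r at *
  have n1 := mul_nonneg ha (sq_nonneg ‖v - φ n‖)
  have n2 := mul_nonneg hb e2
  have n3 := mul_nonneg e1 (sq_nonneg ‖v - φ n‖)
  have n4 := mul_nonneg (sq_nonneg ‖g‖) e2
  have m1 : (p1 + p2 + (p3 + p4)) ^ 2 ≤ 2 * (p1 + p3) ^ 2 + 4 * p2 ^ 2 + 4 * p4 ^ 2 := by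
    linear_combination sq_nonneg (p1 + p3 - p2 - p4) + 2 * sq_nonneg (p2 - p4)
  linear_combination m1 + 2 * h1 + 2 * hQ' + 2 * hN' + 4 * h2 + 4 * h3 + 4 * n1 + 4 * n2
    + 4 * n3 + 4 * n4

theorem laplacian_spec {f : G.L2} (hf : f ∈ G.laplacian.domain) :
    f ∈ G.formDomain ∧ ∀ v ∈ G.formDomain, G.energy f v = inner ℝ (G.laplacian ⟨f, hf⟩) v := by
  have h : (f, G.laplacian ⟨f, hf⟩) ∈ G.laplacian.graph := G.laplacian.mem_graph ⟨f, hf⟩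
  rw [laplacian_graph] at h
  exact h

theorem energy_eq_of_schrodinger {W : lp (fun _ : X => ℝ) ∞} {lam : ℝ} {f g : G.L2}
    (hf : f ∈ (G.schrodinger W).domain) (h : G.schrodinger W ⟨f, hf⟩ - lam • f = g) :
    f ∈ G.formDomain ∧ ∀ v ∈ G.formDomain,
      G.energy f v = inner ℝ (g + lam • f - G.potentialMul W f) v := by
  refine ⟨(laplacian_spec hf).1, fun v hv => ?_⟩
  rw [(laplacian_spec hf).2 v hv]
  congr 1
  have h' : G.potentialMul W f + G.laplacian ⟨f, hf⟩ - lam • f = g := h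
  rw [← h']
  abel

end WeightedGraph

/-! ### Contradiction with a bounded resolvent. -/

theorem proposition6p2 {X : Type*} [Countable X] [MeasurableSpace X] [DiscreteMeasurableSpace X]
    (G : WeightedGraph X) (hL : G.IsCriticalWithGroundState (fun _ => 1))
    (W : lp (fun _ : X => ℝ) ∞) (lam : ℝ) (u : X → ℝ)
    (hu : G.IsGeneralizedEigenfunction (fun x => W x) lam u) (hu1 : ∀ x, |u x| ≤ 1) :
    lam ∈ (G.schrodinger W).realSpectrum := by
  rintro ⟨R, hR, -⟩
  obtain ⟨x, hx⟩ := Function.ne_iff.1 hu.1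
  set D : ℝ := |lam| + ‖W‖ with hDdef
  have hD0 : 0 ≤ D := by positivity
  have hD : ∀ x, |lam - W x| ≤ D := fun x =>
    (abs_sub _ _).trans (by
      have := lp.norm_apply_le_norm ENNReal.top_ne_zero W x
      rw [Real.norm_eq_abs] at this
      linarith)
  -- Inserting the bounds on `Q(g,g)` and `‖g‖²` into `4 (10 Q(g,g) + 4 D ‖g‖²)` gives `K ‖f‖²`. As
  -- `K` does not depend on `e`, the cut-off can be chosen afterwards.
  set K : ℝ := 40 * (‖R‖ + D * ‖R‖ ^ 2) + 16 * D * ‖R‖ ^ 2 with hK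
  have hK0 : 0 ≤ K := by positivity
  have hc : 0 < G.m x * u x ^ 2 := mul_pos (G.m_pos x) (pow_two_pos_of_ne_zero hx)
  obtain ⟨e, hex, he⟩ := hL.critical.exists_energy_lt x (div_pos hc (by positivity : 0 < K + 1))
  have hefin : (Function.support e).Finite := e.hasFiniteSupport
  have hefin' : (Function.support (⇑e * u)).Finite :=
    hefin.subset fun y hy h0 => hy (by simp [h0])
  obtain ⟨f, hf⟩ := WeightedGraph.exists_coe_eq (G := G) hefin'
  have hffin : (Function.support f).Finite := hf ▸ hefin'
  have hfdom := G.mem_formDomain_of_finite hffin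
  obtain ⟨hdom, hRf⟩ := hR f
  set g := R f with hg
  obtain ⟨hgdom, hgE⟩ := WeightedGraph.energy_eq_of_schrodinger hdom hRf
  have hbound := WeightedGraph.sq_energy_add_inner_le (g := G.potentialMul W f - lam • f)
    (a := G.energy e e * 10) (b := G.energy e e * (4 * D)) hffin
    (mul_nonneg (G.energy_self_nonneg _) (by norm_num))
    (mul_nonneg (G.energy_self_nonneg _) (by positivity)) (fun v hv => by
      have h := hu.2.sq_energy_mul_sub_le hu1 hD hefin hv
      rw [← hf, ← WeightedGraph.norm_sq_eq_tsum] at h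
      have hi : inner ℝ (G.potentialMul W f - lam • f) v
          = -∑' x, G.m x * ((lam - W x) * f x * v x) := by
        rw [WeightedGraph.inner_eq_tsum, ← tsum_neg]
        refine tsum_congr fun y => ?_
        rw [WeightedGraph.coe_sub, WeightedGraph.coe_smul, Pi.sub_apply, Pi.smul_apply,
          WeightedGraph.potentialMul_apply, smul_eq_mul]
        ring
      rw [hi, ← sub_eq_add_neg]
      linarith) hgdom
  -- Symmetry of the form and of `W` moves `L + W - lam` onto `g = R f`, where it returns `f`.
  have hself : G.energy f g + inner ℝ (G.potentialMul W f - lam • f) g = ‖f‖ ^ 2 := by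
    rw [WeightedGraph.energy_comm, hgE f hfdom, inner_sub_left, inner_add_left, inner_sub_left,
      WeightedGraph.inner_potentialMul_comm W g f, real_inner_smul_left, real_inner_smul_left,
      real_inner_self_eq_norm_sq, real_inner_comm g f, real_inner_comm g (G.potentialMul W f)]
    ring
  have hgn : ‖g‖ ≤ ‖R‖ * ‖f‖ := R.le_opNorm f
  have hgn2 : ‖g‖ ^ 2 ≤ ‖R‖ ^ 2 * ‖f‖ ^ 2 := by
    rw [← mul_pow]; exact pow_le_pow_left₀ (norm_nonneg _) hgn 2
  -- Testing the resolvent equation with `g` itself bounds its energy.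
  have hgQ : G.energy g g ≤ (‖R‖ + D * ‖R‖ ^ 2) * ‖f‖ ^ 2 := by
    rw [hgE g hgdom, inner_sub_left, inner_add_left, real_inner_smul_left,
      real_inner_self_eq_norm_sq]
    have i1 := real_inner_le_norm f g
    have i2 := neg_le_of_abs_le (abs_real_inner_le_norm (G.potentialMul W g) g)
    have i3 := mul_le_mul_of_nonneg_right (WeightedGraph.norm_potentialMul_le W g) (norm_nonneg g)
    have i4 := mul_le_mul_of_nonneg_right (le_abs_self lam) (sq_nonneg ‖g‖)
    have i5 := mul_le_mul_of_nonneg_left hgn (norm_nonneg f)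
    have i6 := mul_le_mul_of_nonneg_left hgn2 hD0
    rw [hDdef] at i6 ⊢
    linear_combination i1 + i2 + i3 + i4 + i5 + i6
  have hlow : G.m x * u x ^ 2 ≤ ‖f‖ ^ 2 := by
    have := WeightedGraph.mul_sq_le_norm_sq f x
    rwa [hf, Pi.mul_apply, hex, one_mul] at this
  rw [hself] at hbound
  have hQ0 := G.energy_self_nonneg e
  have hup : ‖f‖ ^ 2 * ‖f‖ ^ 2 ≤ (G.energy e e * K) * ‖f‖ ^ 2 := by
    have j1 := mul_le_mul_of_nonneg_left hgQ hQ0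
    have j2 := mul_le_mul_of_nonneg_left hgn2 (mul_nonneg hQ0 hD0)
    rw [hK]
    linear_combination hbound + 40 * j1 + 16 * j2
  -- The quotient by `‖f‖² > 0` leaves `‖f‖² ≤ Q(e,e) K`, whereas `e` was chosen with `Q(e,e) (K +
  -- 1) < m(x) u(x)² ≤ ‖f‖²`.
  have hup' := le_of_mul_le_mul_right hup (hc.trans_le hlow)
  rw [lt_div_iff₀ (by positivity)] at he
  linarith
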